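/- Let $N_C$, $N_R$ and $V$ be countably infinite, pairwise disjoint sets of concept names, role names and variables (each identified with $\mathbb N$ for coding purposes), and fix two distinct role names $r, s \in N_R$. $\mathcal{ALC}$-concepts are given by the grammar $C, D ::= \top \mid A \mid \neg C \mid C \sqcap D \mid \exists \rho.C$ with $A \in N_C$, $\rho \in N_R$, with their usual semantics in interpretations with a non-empty domain; an $\mathcal{ALC}$-TBox is a finite set of inclusions $C \sqsubseteq D$ of $\mathcal{ALC}$-concepts, and an interpretation is a model of it if $C^{\mathcal I} \subseteq D^{\mathcal I}$ for each of them. For a language $L$ of finite words over role names, an element $e$ is $L$-reachable from an element $d$ in $\mathcal I$ if there is a word $\rho_1\cdots\rho_n \in L$ and elements $d = d_0, d_1, \ldots, d_n = e$ with $(d_{i-1}, d_i) \in \rho_i^{\mathcal I}$ for $1 \le i \le n$. Let $$\mathbb{L} = \{\, r,\ s,\ r^*,\ s^*,\ \{ r^n s^n \mid n \in \mathbb{N} \} \,\}$$ (where $r$ and $s$ stand for the languages consisting of the corresponding one-letter word). An $\mathbb{L}$-conjunctive query is given by the grammar $q, q' ::= \bot \mid A(x) \mid \rho(x,y) \mid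 L(x,y) \mid q \wedge q'$ with $A \in N_C$, $\rho \in N_R$, $L \in \mathbb{L}$ and $x, y \in V$. An interpretation $\mathcal I$ satisfies $q$ if some assignment of domain elements to variables makes $q$ true, where $\bot$ is false, $A(x)$, $\rho(x,y)$ and $\wedge$ have their usual meaning, and $L(x,y)$ holds if the value of $y$ is $L$-reachable from the value of $x$. A TBox $\mathcal T$ entails $q$ if every model of $\mathcal T$ satisfies $q$. Theorem. The entailment problem of $\mathbb{L}$-conjunctive queries over $\mathcal{ALC}$-TBoxes is undecidable: there is no algorithm that decides, given an $\mathcal{ALC}$-TBox $\mathcal T$ and an $\mathbb{L}$-conjunctive query $q$, whether $\mathcal T$ entails $q$. -/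

import Mathlib

open scoped Computability

universe u

namespace DL

/-! The countably infinite sets of names and variables are copies of `ℕ`; the kinds of names are
kept apart by the constructors and fields in which they are used. -/

abbrev IndividualName := ℕ
abbrev ConceptName := ℕ
abbrev RoleName := ℕ
abbrev Var := ℕ

/-- The concepts of the description logic `ALC`: `⊤ | A | ¬ C | C ⊓ D | ∃ρ.C`. -/
inductive Concept : Type
  | top : Concept
  | atom (A : ConceptName) : Concept
  | neg (C : Concept) : Concept
  | inter (C D : Concept) : Concept
  | ex (ρ : RoleName) (C : Concept) : Concept

/-- A general concept inclusion `C ⊑ D`, as the pair `(C, D)`. -/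
abbrev GCI := Concept × Concept

/-- An `ALC`-TBox: a finite set of general concept inclusions, written as a list. -/
abbrev TBox := List GCI

/-- Interpretations: a non-empty domain and an interpretation of all names. -/
structure Interpretation where
  Dom : Type u
  nonempty : Nonempty Dom
  ind : IndividualName → Dom
  conc : ConceptName → Set Dom
  role : RoleName → Set (Dom × Dom)

/-- The extension of a concept in an interpretation. -/
def Concept.ext (I : Interpretation.{u}) : Concept → Set I.Dom
  | .top => Set.univ
  | .atom A => I.conc A
  | .neg C => (C.ext I)ᶜ
  | .inter C D => C.ext I ∩ D.ext I
  | .ex ρ C => {d | ∃ e ∈ C.ext I, (d, e) ∈ I.role ρ}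

/-- `I ⊨ T`: every inclusion of the TBox holds in `I`. -/
def Interpretation.IsModel (I : Interpretation.{u}) (T : TBox) : Prop :=
  ∀ g ∈ T, g.1.ext I ⊆ g.2.ext I

/-- The alphabet of path expressions: role names and tests `A?` of concept names. -/
inductive Letter : Type
  | role (ρ : RoleName) : Letter
  | test (A : ConceptName) : Letter

/-- One step along a letter: a role edge, or staying at an element of the tested concept. -/
def Interpretation.Step (I : Interpretation.{u}) : Letter → I.Dom → I.Dom → Prop
  | .role ρ, d, e => (d, e) ∈ I.role ρ
  | .test A, d, e => d = e ∧ d ∈ I.conc A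

/-- There is a path from `d` to `e` whose consecutive steps are along the letters of the word. -/
def Interpretation.Path (I : Interpretation.{u}) : List Letter → I.Dom → I.Dom → Prop
  | [], d, e => d = e
  | a :: w, d, e => ∃ f, I.Step a d f ∧ I.Path w f e

/-- `e` is `L`-reachable from `d`. -/
def Interpretation.Reaches (I : Interpretation.{u}) (L : Language Letter) (d e : I.Dom) : Prop :=
  ∃ w ∈ L, I.Path w d e

/-- Names for the five languages `r`, `s`, `r*`, `s*`, `{rⁿ sⁿ | n ∈ ℕ}`. -/
inductive LangName : Type
  | r : LangName
  | s : LangName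
  | rStar : LangName
  | sStar : LangName
  | rnsn : LangName

/-- The language named by a `LangName`, for given role names `r` and `s`. -/
def LangName.lang (r s : RoleName) : LangName → Language Letter
  | .r => {[Letter.role r]}
  | .s => {[Letter.role s]}
  | .rStar => ({[Letter.role r]} : Language Letter)∗
  | .sStar => ({[Letter.role s]} : Language Letter)∗
  | .rnsn => {w | ∃ n : ℕ,
      w = List.replicate n (Letter.role r) ++ List.replicate n (Letter.role s)}

/-- Conjunctive queries enriched with the five languages:
`⊥ | A(x) | ρ(x,y) | L(x,y) | q ∧ q'`. -/
inductive CQ : Type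
  | bot : CQ
  | conc (A : ConceptName) (x : Var) : CQ
  | role (ρ : RoleName) (x y : Var) : CQ
  | lang (L : LangName) (x y : Var) : CQ
  | and (q q' : CQ) : CQ

/-- Truth of a query under a variable assignment. -/
def CQ.Holds (r s : RoleName) (I : Interpretation.{u}) (η : Var → I.Dom) : CQ → Prop
  | .bot => False
  | .conc A x => η x ∈ I.conc A
  | .role ρ x y => (η x, η y) ∈ I.role ρ
  | .lang L x y => I.Reaches (L.lang r s) (η x) (η y)
  | .and q q' => q.Holds r s I η ∧ q'.Holds r s I η

/-- `I ⊨ q`: the query has a match in `I`. -/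
def Interpretation.Satisfies (r s : RoleName) (I : Interpretation.{u}) (q : CQ) : Prop :=
  ∃ η : Var → I.Dom, q.Holds r s I η

/-- `T ⊨ q`: every model of the TBox satisfies the query. -/
def TBox.Entails (r s : RoleName) (T : TBox) (q : CQ) : Prop :=
  ∀ I : Interpretation.{u}, I.IsModel T → I.Satisfies r s q

/-! Concepts and queries as inputs of algorithms: explicit bijective codings by natural numbers,
given by recursion on the syntax. Lists and pairs are coded by the library. -/

def Concept.code : Concept → ℕ
  | .top => 0
  | .atom A => 4 * A + 1
  | .neg C => 4 * C.code + 2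
  | .inter C D => 4 * Nat.pair C.code D.code + 3
  | .ex ρ C => 4 * Nat.pair ρ C.code + 4

def Concept.ofCode : ℕ → Concept
  | 0 => .top
  | n + 1 =>
    have h : n / 4 < n + 1 := by omega
    have h1 : (n / 4).unpair.1 < n + 1 := lt_of_le_of_lt (Nat.unpair_left_le _) h
    have h2 : (n / 4).unpair.2 < n + 1 := lt_of_le_of_lt (Nat.unpair_right_le _) h
    match n % 4 with
    | 0 => .atom (n / 4)
    | 1 => .neg (Concept.ofCode (n / 4))
    | 2 => .inter (Concept.ofCode (n / 4).unpair.1) (Concept.ofCode (n / 4).unpair.2)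
    | _ => .ex (n / 4).unpair.1 (Concept.ofCode (n / 4).unpair.2)

theorem Concept.ofCode_code (C : Concept) : Concept.ofCode C.code = C := by
  induction C with
  | top => simp [Concept.code, Concept.ofCode]
  | atom A =>
    have h1 : ∀ m : ℕ, 4 * m % 4 = 0 := fun m => by omega
    have h2 : ∀ m : ℕ, 4 * m / 4 = m := fun m => by omega
    rw [Concept.code, Concept.ofCode]
    simp only [h1, h2]
  | neg C ih =>
    have h1 : (4 * C.code + 1) % 4 = 1 := by omega
    have h2 : (4 * C.code + 1) / 4 = C.code := by omega
    rw [Concept.code, Concept.ofCode]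
    simp only [h1, h2, ih]
  | inter C D ihC ihD =>
    have h1 : (4 * Nat.pair C.code D.code + 2) % 4 = 2 := by omega
    have h2 : (4 * Nat.pair C.code D.code + 2) / 4 = Nat.pair C.code D.code := by omega
    rw [Concept.code, Concept.ofCode]
    simp only [h1, h2, Nat.unpair_pair, ihC, ihD]
  | ex ρ C ih =>
    have h1 : (4 * Nat.pair ρ C.code + 3) % 4 = 3 := by omega
    have h2 : (4 * Nat.pair ρ C.code + 3) / 4 = Nat.pair ρ C.code := by omega
    rw [Concept.code, Concept.ofCode]
    simp only [h1, h2, Nat.unpair_pair, ih]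

theorem Concept.code_ofCode (n : ℕ) : (Concept.ofCode n).code = n := by
  induction n using Nat.strong_induction_on with
  | _ n ih =>
    cases n with
    | zero => simp [Concept.code, Concept.ofCode]
    | succ n =>
      have h : n / 4 < n + 1 := by omega
      have h1 := lt_of_le_of_lt (Nat.unpair_left_le (n / 4)) h
      have h2 := lt_of_le_of_lt (Nat.unpair_right_le (n / 4)) h
      have hlt : n % 4 < 4 := Nat.mod_lt _ (by norm_num)
      have hd := Nat.div_add_mod n 4
      rw [Concept.ofCode]
      generalize n % 4 = k at hlt hd
      interval_cases k <;> simp only [Concept.code, ih _ h, ih _ h1, ih _ h2, Nat.pair_unpair] <;>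
        omega

instance : Denumerable Concept :=
  Denumerable.mk' ⟨Concept.code, Concept.ofCode, Concept.ofCode_code, Concept.code_ofCode⟩

def LangName.code : LangName → ℕ
  | .r => 0
  | .s => 1
  | .rStar => 2
  | .sStar => 3
  | .rnsn => 4

def CQ.code : CQ → ℕ
  | .bot => 0
  | .lang L x y => 8 * Nat.pair x y + L.code + 1
  | .conc A x => 8 * Nat.pair A x + 6
  | .role ρ x y => 8 * Nat.pair ρ (Nat.pair x y) + 7
  | .and q q' => 8 * Nat.pair q.code q'.code + 8

def CQ.ofCode : ℕ → CQ
  | 0 => .bot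
  | n + 1 =>
    have h : n / 8 < n + 1 := by omega
    have h1 : (n / 8).unpair.1 < n + 1 := lt_of_le_of_lt (Nat.unpair_left_le _) h
    have h2 : (n / 8).unpair.2 < n + 1 := lt_of_le_of_lt (Nat.unpair_right_le _) h
    match n % 8 with
    | 0 => .lang .r (n / 8).unpair.1 (n / 8).unpair.2
    | 1 => .lang .s (n / 8).unpair.1 (n / 8).unpair.2
    | 2 => .lang .rStar (n / 8).unpair.1 (n / 8).unpair.2
    | 3 => .lang .sStar (n / 8).unpair.1 (n / 8).unpair.2
    | 4 => .lang .rnsn (n / 8).unpair.1 (n / 8).unpair.2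
    | 5 => .conc (n / 8).unpair.1 (n / 8).unpair.2
    | 6 => .role (n / 8).unpair.1 (n / 8).unpair.2.unpair.1 (n / 8).unpair.2.unpair.2
    | _ => .and (CQ.ofCode (n / 8).unpair.1) (CQ.ofCode (n / 8).unpair.2)

theorem CQ.ofCode_code (q : CQ) : CQ.ofCode q.code = q := by
  have hm : ∀ m k, k < 8 → (8 * m + k) % 8 = k := fun m k hk => by omega
  have hd : ∀ m k, k < 8 → (8 * m + k) / 8 = m := fun m k hk => by omega
  induction q with
  | bot => simp [CQ.code, CQ.ofCode]
  | conc A x =>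
    rw [CQ.code, CQ.ofCode]
    simp only [hm _ 5 (by norm_num), hd _ 5 (by norm_num), Nat.unpair_pair]
  | role ρ x y =>
    rw [CQ.code, CQ.ofCode]
    simp only [hm _ 6 (by norm_num), hd _ 6 (by norm_num), Nat.unpair_pair]
  | lang L x y =>
    rw [CQ.code, CQ.ofCode]
    cases L
    · simp only [LangName.code, hm _ 0 (by norm_num), hd _ 0 (by norm_num), Nat.unpair_pair]
    · simp only [LangName.code, hm _ 1 (by norm_num), hd _ 1 (by norm_num), Nat.unpair_pair]
    · simp only [LangName.code, hm _ 2 (by norm_num), hd _ 2 (by norm_num), Nat.unpair_pair]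
    · simp only [LangName.code, hm _ 3 (by norm_num), hd _ 3 (by norm_num), Nat.unpair_pair]
    · simp only [LangName.code, hm _ 4 (by norm_num), hd _ 4 (by norm_num), Nat.unpair_pair]
  | and q q' ih ih' =>
    rw [CQ.code, CQ.ofCode]
    simp only [hm _ 7 (by norm_num), hd _ 7 (by norm_num), Nat.unpair_pair, ih, ih']

theorem CQ.code_ofCode (n : ℕ) : (CQ.ofCode n).code = n := by
  induction n using Nat.strong_induction_on with
  | _ n ih =>
    cases n with
    | zero => simp [CQ.code, CQ.ofCode]
    | succ n =>
      have h : n / 8 < n + 1 := by omega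
      have h1 := lt_of_le_of_lt (Nat.unpair_left_le (n / 8)) h
      have h2 := lt_of_le_of_lt (Nat.unpair_right_le (n / 8)) h
      have hlt : n % 8 < 8 := Nat.mod_lt _ (by norm_num)
      have hd := Nat.div_add_mod n 8
      rw [CQ.ofCode]
      generalize n % 8 = k at hlt hd
      interval_cases k <;>
        simp only [CQ.code, LangName.code, ih _ h1, ih _ h2, Nat.pair_unpair] <;> omega

instance : Denumerable CQ :=
  Denumerable.mk' ⟨CQ.code, CQ.ofCode, CQ.ofCode_code, CQ.code_ofCode⟩

end DL

namespace DL

/-! ### Paths and derived concepts -/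

namespace Interpretation

variable (I : Interpretation.{u})

/-! Halting reduces to entailment: a machine and an input give a TBox and a query such that the
query is entailed exactly when the machine halts. The intended counter-model is an `r`-chain of
nodes `(m, 0)` with an `s`-chain hanging from each node. Successive configurations are written down
columns that lie `S` nodes apart.

A TBox controls what happens along a single column but cannot compare two columns; the query does
this. A path `rⁿsⁿ` from node `m` leads to depth `n` of column `m + n`. So if two elements are
reached in this way from one node `x`, and their columns start `S` edges apart, then their depths
differ by exactly `S`. The query asks for such a pair in which the first element announces a bit and
the second does not expect it. Avoiding the query therefore means copying the announced bits of each
column into the next one, `S` places lower. Letters are coded one-hot, so copying the ones alone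
determines the letter.

An arbitrary counter-model need not be a grid, but columns can be selected from it
(`tiling_of_not_entails`). Depth `k` is compared only if some `x` lies `k` edges before the column,
so comparison reaches only as deep as the column is far from the root. This distance grows by `S`
per column. A configuration also grows by two cells per step, one on each side, so `S` is taken to
be the length of two coded letters and the compared part always covers the whole row. A flag
travelling with the end of the row makes the local rule ignore everything below it.

Hence a non-halting run yields a fully compared tiling and a counter-model (`rows_of_not_dom`,
`tiling_of_rows`, `not_entails_of_tiling`), while a counter-model yields a partially compared tiling
that still forces an infinite run (`tiling_of_not_entails`, `rows_of_tiling`, `not_dom_of_rows`). -/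

theorem path_append (v w : List Letter) (d e : I.Dom) :
    I.Path (v ++ w) d e ↔ ∃ f, I.Path v d f ∧ I.Path w f e := by
  induction v generalizing d with
  | nil => simp [Path]
  | cons a v ih =>
    simp only [List.cons_append, Path, ih]
    constructor
    · rintro ⟨f, hf, g, h1, h2⟩
      exact ⟨g, ⟨f, hf, h1⟩, h2⟩
    · rintro ⟨g, ⟨f, hf, h1⟩, h2⟩
      exact ⟨f, hf, g, h1, h2⟩

/-- `e` is reached from `d` along `n` edges of the role `ρ`. -/
def RolePath (ρ : RoleName) (n : ℕ) (d e : I.Dom) : Prop :=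
  I.Path (List.replicate n (Letter.role ρ)) d e

variable {I}

theorem rolePath_zero {ρ : RoleName} {d e : I.Dom} : I.RolePath ρ 0 d e ↔ d = e := Iff.rfl

theorem rolePath_succ {ρ : RoleName} {n : ℕ} {d e : I.Dom} :
    I.RolePath ρ (n + 1) d e ↔ ∃ f, (d, f) ∈ I.role ρ ∧ I.RolePath ρ n f e := Iff.rfl

theorem rolePath_add {ρ : RoleName} {m n : ℕ} {d e : I.Dom} :
    I.RolePath ρ (m + n) d e ↔ ∃ f, I.RolePath ρ m d f ∧ I.RolePath ρ n f e := by
  rw [RolePath, List.replicate_add, path_append]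
  rfl

theorem rolePath_one {ρ : RoleName} {d e : I.Dom} :
    I.RolePath ρ 1 d e ↔ (d, e) ∈ I.role ρ := by
  simp [rolePath_succ, rolePath_zero]

theorem rolePath_of_seq {ρ : RoleName} (g : ℕ → I.Dom)
    (hg : ∀ k, (g k, g (k + 1)) ∈ I.role ρ) (n : ℕ) : I.RolePath ρ n (g 0) (g n) := by
  induction n with
  | zero => exact rolePath_zero.2 rfl
  | succ n ih => exact rolePath_add.2 ⟨_, ih, rolePath_one.2 (hg n)⟩

theorem exists_seq_of_rolePath {ρ : RoleName} {n : ℕ} {d e : I.Dom} (h : I.RolePath ρ n d e) :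
    ∃ g : ℕ → I.Dom, g 0 = d ∧ g n = e ∧ ∀ k < n, (g k, g (k + 1)) ∈ I.role ρ := by
  induction n generalizing d with
  | zero => exact ⟨fun _ => d, rfl, rolePath_zero.1 h, fun k hk => absurd hk (Nat.not_lt_zero k)⟩
  | succ n ih =>
    obtain ⟨f, hf, h⟩ := rolePath_succ.1 h
    obtain ⟨g, g0, gn, hg⟩ := ih h
    refine ⟨fun k => Nat.casesOn k d g, rfl, gn, fun k hk => ?_⟩
    cases k with
    | zero => simpa [g0] using hf
    | succ k => exact hg k (Nat.lt_of_succ_lt_succ hk)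

theorem reaches_rnsn {r s : RoleName} {d e : I.Dom} :
    I.Reaches (LangName.rnsn.lang r s) d e ↔
      ∃ n f, I.RolePath r n d f ∧ I.RolePath s n f e := by
  constructor
  · rintro ⟨w, ⟨n, rfl⟩, h⟩
    obtain ⟨f, h1, h2⟩ := (path_append I _ _ _ _).1 h
    exact ⟨n, f, h1, h2⟩
  · rintro ⟨n, f, h1, h2⟩
    exact ⟨_, ⟨n, rfl⟩, (path_append I _ _ _ _).2 ⟨f, h1, h2⟩⟩

theorem reaches_sStar {r s : RoleName} {d e : I.Dom} :
    I.Reaches (LangName.sStar.lang r s) d e ↔ ∃ n, I.RolePath s n d e := by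
  constructor
  · rintro ⟨w, hw, h⟩
    obtain ⟨l, rfl, hl⟩ := Language.mem_kstar.1 hw
    have hl' : l = List.replicate l.length [Letter.role s] :=
      List.eq_replicate_of_mem fun y hy => hl y hy
    rw [hl', List.flatten_replicate_singleton] at h
    exact ⟨_, h⟩
  · rintro ⟨n, h⟩
    refine ⟨_, Language.mem_kstar.2 ⟨List.replicate n [Letter.role s], ?_, ?_⟩, h⟩
    · rw [List.flatten_replicate_singleton]
    · intro y hy
      exact List.eq_of_mem_replicate hy

end Interpretation

namespace Concept

def bot : Concept := .neg .top

def or (C D : Concept) : Concept := .neg (.inter (.neg C) (.neg D))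

def disj (l : List Concept) : Concept := l.foldr or bot

def exIter (ρ : RoleName) (n : ℕ) (C : Concept) : Concept := (Concept.ex ρ)^[n] C

variable {I : Interpretation.{u}} {d : I.Dom}

theorem mem_ext_disj {l : List Concept} : d ∈ (disj l).ext I ↔ ∃ C ∈ l, d ∈ C.ext I := by
  induction l with
  | nil => simp [disj, bot, ext]
  | cons C l ih =>
    rw [List.exists_mem_cons_iff, ← ih]
    simp only [disj, List.foldr_cons, or, ext, Set.mem_compl_iff, Set.mem_inter_iff]
    tauto

theorem mem_ext_exIter {ρ : RoleName} {n : ℕ} {C : Concept} :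
    d ∈ (exIter ρ n C).ext I ↔ ∃ e ∈ C.ext I, I.RolePath ρ n d e := by
  induction n generalizing d with
  | zero => simp [exIter, Interpretation.rolePath_zero]
  | succ n ih =>
    rw [exIter, Function.iterate_succ_apply']
    simp only [← exIter.eq_1, ext, Set.mem_ofPred_eq, ih, Interpretation.rolePath_succ]
    constructor
    · rintro ⟨f, ⟨e, he, h1⟩, h2⟩
      exact ⟨e, he, f, h2, h1⟩
    · rintro ⟨e, he, f, h2, h1⟩
      exact ⟨f, ⟨e, he, h1⟩, h2⟩

end Concept

/-! ### Tile systems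

Columns of tiles hang from the nodes of an `r`-chain along `s`-edges. A tile announces a bit
`own` and expects a bit `pred` of the tile that lies `shift` positions higher in the previous
column. -/

structure TileSystem (τ : Type) where
  heads : Set τ
  adj : τ → Set τ
  own : Set τ
  pred : Set τ
  shift : ℕ

namespace TileSystem

variable {τ : Type} (P : TileSystem τ)

/-- A sequence of columns in which bits are compared where `R` says so; `β` are the bits announced
by the column before the first one. -/
def Tiling (R : ℕ → ℕ → Prop) (β : List Bool) : Prop :=
  ∃ f : ℕ → ℕ → τ, (∀ n, f n 0 ∈ P.heads) ∧ (∀ n k, f n (k + 1) ∈ P.adj (f n k)) ∧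
    (∀ k, β[k]? = some true → f 0 (k + P.shift) ∈ P.pred) ∧
    ∀ n k, R n k → f n k ∈ P.own → f (n + 1) (k + P.shift) ∈ P.pred

variable [Fintype τ]

/-- Concept names: `0` marks an announced bit, `1` the absence of an expected bit (queries have no
negation), `2` the heads of columns, and those from `3` on are tiles. -/
noncomputable def tile (t : τ) : Concept := .atom (3 + (Fintype.equivFin τ t : ℕ))

open scoped Classical in
noncomputable def anyOf (S : Set τ) : Concept :=
  Concept.disj ((Finset.univ.filter (· ∈ S)).toList.map tile)

theorem mem_ext_anyOf {I : Interpretation.{u}} {d : I.Dom} {S : Set τ} :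
    d ∈ (anyOf S).ext I ↔ ∃ t ∈ S, d ∈ (tile t).ext I := by
  simp [anyOf, Concept.mem_ext_disj]

open scoped Classical in
/-- The inclusions for one tile: it is continued along `s`, and its bits are visible. -/
noncomputable def tileRules (s : RoleName) (t : τ) : TBox :=
  [(tile t, .ex s (anyOf (P.adj t))),
    (tile t, if t ∈ P.own then .atom 0 else .top),
    (tile t, if t ∈ P.pred then .top else .atom 1)]

/-- The part of the TBox that does not depend on the initial bits. -/
noncomputable def rules (r s : RoleName) : TBox :=
  (.atom 2, anyOf P.heads) :: (.atom 2, .exIter r P.shift (.atom 2)) ::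
    (Finset.univ : Finset τ).toList.flatMap (P.tileRules s)

def wordConcept (s : RoleName) (β : List Bool) : Concept :=
  β.foldr (fun b C => .inter (if b then .atom 0 else .top) (.ex s C)) .top

/-- The `β.length` leading edges leave room for a common ancestor `x` of every bit of `β`. -/
def startConcept (r s : RoleName) (S : ℕ) (β : List Bool) : Concept :=
  .exIter r β.length (.inter (wordConcept s β) (.exIter r S (.atom 2)))

/-- The role `r + s + 1` differs from `r` and `s`, so the edges that force a root are invisible to
the query. -/
noncomputable def tbox (r s : RoleName) (β : List Bool) : TBox :=
  (.top, .ex (r + s + 1) (startConcept r s P.shift β)) :: P.rules r s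

/-- The query for a pair of compared positions that violates the comparison. -/
def query (r : RoleName) (S : ℕ) : CQ :=
  .and (.lang .rnsn 0 1) <| .and (.lang .rnsn 0 2) <| .and (.lang .sStar 3 1) <|
    .and (.lang .sStar (3 + S) 2) <| .and (.conc 1 2) <|
      (List.range S).foldr (fun i q => .and (.role r (3 + i) (3 + (i + 1))) q) (.conc 0 1)

/-- The `s*` atoms tie `y₁` and `y₂` to columns through `u` and `v`, and the path from `u` to `v`
fixes the distance of these columns. -/
theorem satisfies_query {r s : RoleName} {S : ℕ} {I : Interpretation.{u}} :
    I.Satisfies r s (query r S) ↔ ∃ x y₁ y₂ u v : I.Dom,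
      (∃ i f, I.RolePath r i x f ∧ I.RolePath s i f y₁) ∧
      (∃ j f, I.RolePath r j x f ∧ I.RolePath s j f y₂) ∧
      (∃ k, I.RolePath s k u y₁) ∧ (∃ k, I.RolePath s k v y₂) ∧ I.RolePath r S u v ∧
      y₁ ∈ I.conc 0 ∧ y₂ ∈ I.conc 1 := by
  have hfold : ∀ (η : Var → I.Dom) (l : List ℕ),
      (l.foldr (fun i q => CQ.and (.role r (3 + i) (3 + (i + 1))) q) (.conc 0 1)).Holds r s I η ↔
        (∀ i ∈ l, (η (3 + i), η (3 + (i + 1))) ∈ I.role r) ∧ η 1 ∈ I.conc 0 := by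
    intro η l
    induction l with
    | nil => simp [CQ.Holds]
    | cons i l ih => simp only [List.foldr_cons, CQ.Holds, ih, List.forall_mem_cons, and_assoc]
  simp only [Interpretation.Satisfies, query, CQ.Holds, hfold, Interpretation.reaches_rnsn,
    Interpretation.reaches_sStar, List.mem_range]
  constructor
  · rintro ⟨η, h1, h2, h3, h4, h5, h6, h7⟩
    refine ⟨_, _, _, _, _, h1, h2, h3, h4, ?_, h7, h5⟩
    clear h4
    induction S with
    | zero => exact Interpretation.rolePath_zero.2 rfl
    | succ S ih =>
      exact Interpretation.rolePath_add.2 ⟨_, ih fun i hi => h6 i (hi.trans S.lt_succ_self),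
        Interpretation.rolePath_one.2 (h6 S S.lt_succ_self)⟩
  · rintro ⟨x, y₁, y₂, u, v, h1, h2, h3, h4, h5, h6, h7⟩
    obtain ⟨g, rfl, rfl, hg⟩ := Interpretation.exists_seq_of_rolePath h5
    -- Variables `0`, `1`, `2` hold `x`, `y₁`, `y₂`; those from `3` to `3 + S` run along the path
    -- from `u` to `v`.
    refine ⟨fun n => match n with | 0 => x | 1 => y₁ | 2 => y₂ | n + 3 => g n, h1, h2, h3, ?_, h7,
      ?_, h6⟩
    · rw [Nat.add_comm 3]
      exact h4
    · intro i hi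
      rw [Nat.add_comm 3, Nat.add_comm 3]
      exact hg i hi

theorem exists_of_mem_wordConcept {s : RoleName} {I : Interpretation.{u}} {β : List Bool}
    {d : I.Dom} (h : d ∈ (wordConcept s β).ext I) {k : ℕ} (hk : β[k]? = some true) :
    ∃ e ∈ I.conc 0, I.RolePath s k d e := by
  induction β generalizing d k with
  | nil => simp at hk
  | cons b β ih =>
    obtain ⟨h1, f, h2, h3⟩ := h
    cases k with
    | zero =>
      have hb : b = true := by simpa using hk
      subst hb
      exact ⟨d, h1, Interpretation.rolePath_zero.2 rfl⟩
    | succ k =>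
      obtain ⟨e, he, hp⟩ := ih h2 (by simpa using hk)
      exact ⟨e, he, Interpretation.rolePath_succ.2 ⟨f, h3, hp⟩⟩

theorem isModel_rules {r s : RoleName} {I : Interpretation.{u}} : I.IsModel (P.rules r s) ↔
    (∀ d ∈ I.conc 2, ∃ t ∈ P.heads, d ∈ (tile t).ext I) ∧
    (∀ d ∈ I.conc 2, ∃ e ∈ I.conc 2, I.RolePath r P.shift d e) ∧
    ∀ t, ∀ d ∈ (tile t).ext I, (∃ e, (∃ t' ∈ P.adj t, e ∈ (tile t').ext I) ∧ (d, e) ∈ I.role s) ∧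
      (t ∈ P.own → d ∈ I.conc 0) ∧ (t ∉ P.pred → d ∈ I.conc 1) := by
  simp only [Interpretation.IsModel, rules, List.forall_mem_cons, List.mem_flatMap,
    Finset.mem_toList, Finset.mem_univ, true_and, forall_exists_index, tileRules]
  refine and_congr ?_ (and_congr ?_ ?_)
  · simp only [Set.subset_def, mem_ext_anyOf]
    rfl
  · simp only [Set.subset_def, Concept.mem_ext_exIter]
    rfl
  · rw [forall_comm]
    refine forall_congr' fun t => ?_
    simp only [List.mem_cons, List.not_mem_nil, or_false, forall_eq_or_imp, forall_eq,
      Set.subset_def]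
    rw [← forall_and, ← forall_and]
    refine forall_congr' fun d => ?_
    rw [← imp_and, ← imp_and]
    refine imp_congr_right fun _ => and_congr ?_ (and_congr ?_ ?_)
    · simp only [Concept.ext, Set.mem_ofPred_eq, mem_ext_anyOf]
    · split_ifs with h <;> simp [h, Concept.ext]
    · split_ifs with h <;> simp [h, Concept.ext]

/-- Elements may coincide or carry several tiles, so a chain of heads and a tile for each chosen
element below them are selected. The bound on `k` is the distance of the `n`-th head from the root.
-/
theorem tiling_of_not_entails {r s : RoleName} {β : List Bool}
    (h : ¬ TBox.Entails.{u} r s (P.tbox r s β) (query r P.shift)) :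
    P.Tiling (fun n k => k < β.length + P.shift * (n + 1)) β := by
  classical
  simp only [TBox.Entails, not_forall] at h
  obtain ⟨I, hI, hq⟩ := h
  rw [Interpretation.IsModel, tbox, List.forall_mem_cons] at hI
  obtain ⟨hstart, hrules⟩ := hI
  obtain ⟨hheads, hnext, htile⟩ := (P.isModel_rules).1 hrules
  obtain ⟨root₀⟩ := I.nonempty
  obtain ⟨root, hroot, -⟩ := hstart (Set.mem_univ root₀)
  obtain ⟨c₀, ⟨hword, hD⟩, hpath⟩ := Concept.mem_ext_exIter.1 hroot
  obtain ⟨d₀, hd₀, hpath₀⟩ := Concept.mem_ext_exIter.1 hD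
  choose! nxt hnxt hnxtp using hnext
  let D : ℕ → I.Dom := fun n => nxt^[n] d₀
  have hDs : ∀ n, D (n + 1) = nxt (D n) := fun n => Function.iterate_succ_apply' _ _ _
  have hD2 : ∀ n, D n ∈ I.conc 2 := by
    intro n
    induction n with
    | zero => exact hd₀
    | succ n ih => rw [hDs]; exact hnxt _ ih
  have hDp : ∀ n, I.RolePath r P.shift (D n) (D (n + 1)) := fun n => by
    rw [hDs]; exact hnxtp _ (hD2 n)
  have hrootp : ∀ n, I.RolePath r (β.length + P.shift * (n + 1)) root (D n) := by
    intro n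
    induction n with
    | zero =>
      rw [zero_add, mul_one]
      exact Interpretation.rolePath_add.2 ⟨_, hpath, hpath₀⟩
    | succ n ih =>
      have := Interpretation.rolePath_add.2 ⟨_, ih, hDp n⟩
      rwa [show β.length + P.shift * (n + 1 + 1) = β.length + P.shift * (n + 1) + P.shift by ring]
  have hcol : ∀ n, ∃ g : ℕ → I.Dom × τ, (g 0).1 = D n ∧ (g 0).2 ∈ P.heads ∧
      ∀ k, (g k).1 ∈ (tile (g k).2).ext I ∧ (g (k + 1)).2 ∈ P.adj (g k).2 ∧
        ((g k).1, (g (k + 1)).1) ∈ I.role s := by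
    intro n
    obtain ⟨t₀, ht₀, hdt₀⟩ := hheads _ (hD2 n)
    have hstep : ∀ p : {p : I.Dom × τ // p.1 ∈ (tile p.2).ext I},
        ∃ p' : {p : I.Dom × τ // p.1 ∈ (tile p.2).ext I}, p'.1.2 ∈ P.adj p.1.2 ∧
          (p.1.1, p'.1.1) ∈ I.role s := by
      rintro ⟨⟨d, t⟩, hp⟩
      obtain ⟨⟨e, ⟨t', ht', he⟩, hde⟩, -⟩ := htile t d hp
      exact ⟨⟨(e, t'), he⟩, ht', hde⟩
    choose nx hnx using hstep
    refine ⟨fun k => (nx^[k] ⟨(D n, t₀), hdt₀⟩).1, rfl, ht₀,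
      fun k => ⟨(nx^[k] ⟨(D n, t₀), hdt₀⟩).2, ?_⟩⟩
    simp only [Function.iterate_succ_apply']
    exact hnx _
  choose g hg0 hgh hg using hcol
  have hgp : ∀ n k, I.RolePath s k (D n) (g n k).1 := by
    intro n k
    have := Interpretation.rolePath_of_seq (fun k => (g n k).1) (fun k => (hg n k).2.2) k
    simpa only [hg0] using this
  -- The ancestor `x` is taken `k` edges before `c` on the path from the root, which needs `k ≤ m`.
  -- A missing expected bit would then complete a match of the query.
  have key : ∀ (c : I.Dom) (m k : ℕ) (y : I.Dom) (n : ℕ), k ≤ m → I.RolePath r m root c →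
      I.RolePath r P.shift c (D n) → I.RolePath s k c y → y ∈ I.conc 0 →
      (g n (k + P.shift)).2 ∈ P.pred := by
    intro c m k y n hk hc hcd hy hy0
    by_contra hpred
    obtain ⟨m, rfl⟩ := Nat.exists_eq_add_of_le' hk
    obtain ⟨x, -, hx⟩ := Interpretation.rolePath_add.1 hc
    exact hq (satisfies_query.2 ⟨x, y, (g n (k + P.shift)).1, c, D n, ⟨k, c, hx, hy⟩,
      ⟨k + P.shift, D n, Interpretation.rolePath_add.2 ⟨c, hx, hcd⟩, hgp _ _⟩, ⟨k, hy⟩,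
      ⟨_, hgp _ _⟩, hcd, hy0, (htile _ _ (hg n _).1).2.2 hpred⟩)
  refine ⟨fun n k => (g n k).2, hgh, fun n k => (hg n k).2.1, fun k hk => ?_,
    fun n k hk hown => ?_⟩
  · obtain ⟨y, hy0, hy⟩ := exists_of_mem_wordConcept hword hk
    have hlt : k < β.length := by
      by_contra hlt
      rw [List.getElem?_eq_none (not_lt.1 hlt)] at hk
      cases hk
    exact key c₀ _ k y 0 hlt.le hpath hpath₀ hy hy0
  · exact key (D n) _ k _ (n + 1) hk.le (hrootp n) (hDp n) (hgp n k)
      ((htile _ _ (hg n k).1).2.1 hown)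

/-- The interpretation on `ℕ × ℕ` with an `r`-chain `(m, 0)` and `s`-chains `(m, k)` hanging from
its nodes, where the columns `f n` are written on every `P.shift`-th chain. -/
noncomputable abbrev model (r s : RoleName) (β : List Bool) (f : ℕ → ℕ → τ) :
    Interpretation.{u} where
  Dom := ULift.{u} (ℕ × ℕ)
  nonempty := ⟨⟨(0, 0)⟩⟩
  ind _ := ⟨(0, 0)⟩
  conc A := {d | match A with
    | 0 => (d.down.1 = β.length ∧ β[d.down.2]? = some true) ∨
        ∃ n, d.down.1 = β.length + P.shift * (n + 1) ∧ f n d.down.2 ∈ P.own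
    | 1 => ∃ n, d.down.1 = β.length + P.shift * (n + 1) ∧ f n d.down.2 ∉ P.pred
    | 2 => d.down.2 = 0 ∧ ∃ n, d.down.1 = β.length + P.shift * (n + 1)
    | i + 3 => ∃ n, d.down.1 = β.length + P.shift * (n + 1) ∧
        (Fintype.equivFin τ (f n d.down.2) : ℕ) = i}
  role ρ := {p | (ρ = r ∧ p.1.down.2 = 0 ∧ p.2.down = (p.1.down.1 + 1, 0)) ∨
    (ρ = s ∧ p.2.down = (p.1.down.1, p.1.down.2 + 1)) ∨
    (ρ = r + s + 1 ∧ p.2.down = (0, 0))}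

/-! ### The grid-shaped counter-model of a tiling. -/

section Model

variable {P} {r s : RoleName} {β : List Bool} {f : ℕ → ℕ → τ}

theorem mem_role_r (hrs : r ≠ s) {d e : ULift.{u} (ℕ × ℕ)} :
    (d, e) ∈ (P.model r s β f).role r ↔ d.down.2 = 0 ∧ e.down = (d.down.1 + 1, 0) := by
  have h : r ≠ r + s + 1 := (Nat.lt_succ_of_le (Nat.le_add_right r s)).ne
  refine ⟨fun h' => ?_, fun h' => Or.inl ⟨rfl, h'⟩⟩
  rcases h' with ⟨h1, h'⟩ | ⟨h1, h'⟩ | ⟨h1, h'⟩ <;> first | exact h' | contradiction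

theorem mem_role_s (hrs : r ≠ s) {d e : ULift.{u} (ℕ × ℕ)} :
    (d, e) ∈ (P.model r s β f).role s ↔ e.down = (d.down.1, d.down.2 + 1) := by
  have h : s ≠ r + s + 1 := (Nat.lt_succ_of_le (Nat.le_add_left s r)).ne
  have h2 := hrs.symm
  refine ⟨fun h' => ?_, fun h' => Or.inr (Or.inl ⟨rfl, h'⟩)⟩
  rcases h' with ⟨h1, h'⟩ | ⟨h1, h'⟩ | ⟨h1, h'⟩ <;> first | exact h' | contradiction

theorem model_rolePath_s (hrs : r ≠ s) {n : ℕ} {d e : ULift.{u} (ℕ × ℕ)} :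
    (P.model r s β f).RolePath s n d e ↔ e.down = (d.down.1, d.down.2 + n) := by
  induction n generalizing d with
  | zero =>
    rw [Interpretation.rolePath_zero]
    exact ⟨fun h => h ▸ rfl, fun h => ULift.ext _ _ h.symm⟩
  | succ n ih =>
    rw [Interpretation.rolePath_succ]
    constructor
    · rintro ⟨x, hx, h⟩
      rw [ih.1 h, (mem_role_s hrs).1 hx, add_assoc, add_comm 1]
    · intro h
      refine ⟨⟨(d.down.1, d.down.2 + 1)⟩, (mem_role_s hrs).2 rfl, ih.2 ?_⟩
      rw [h, add_assoc, add_comm 1]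

theorem model_rolePath_r (hrs : r ≠ s) {n : ℕ} {d e : ULift.{u} (ℕ × ℕ)} :
    (P.model r s β f).RolePath r n d e ↔
      (n = 0 ∧ e = d) ∨ (d.down.2 = 0 ∧ e.down = (d.down.1 + n, 0)) := by
  induction n generalizing d with
  | zero =>
    rw [Interpretation.rolePath_zero]
    constructor
    · exact fun h => Or.inl ⟨rfl, h.symm⟩
    · rintro (h | ⟨h1, h2⟩)
      · exact h.2.symm
      · exact ULift.ext _ _ (Prod.ext (congrArg Prod.fst h2).symm
          (h1.trans (congrArg Prod.snd h2).symm))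
  | succ n ih =>
    rw [Interpretation.rolePath_succ]
    constructor
    · rintro ⟨x, hx, h⟩
      obtain ⟨h1, h2⟩ := (mem_role_r hrs).1 hx
      refine Or.inr ⟨h1, ?_⟩
      rcases ih.1 h with ⟨rfl, rfl⟩ | ⟨-, h4⟩
      · exact h2
      · rw [h4, h2, add_assoc, add_comm 1]
    · rintro (⟨h, -⟩ | ⟨h1, h2⟩)
      · exact absurd h n.succ_ne_zero
      · refine ⟨⟨(d.down.1 + 1, 0)⟩, (mem_role_r hrs).2 ⟨h1, rfl⟩, ih.2 (Or.inr ⟨rfl, ?_⟩)⟩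
        rw [h2, add_assoc, add_comm 1]

theorem mem_ext_tile {t : τ} {d : ULift.{u} (ℕ × ℕ)} :
    d ∈ (tile t).ext (P.model r s β f) ↔
      ∃ n, d.down.1 = β.length + P.shift * (n + 1) ∧ f n d.down.2 = t := by
  -- The `match` in `model` reduces on `i + 3`, not on `3 + i`.
  rw [tile, add_comm]
  refine exists_congr fun n => and_congr_right fun _ => ?_
  exact Fin.val_inj.trans (Fintype.equivFin τ).injective.eq_iff

theorem mem_wordConcept_model (hrs : r ≠ s) (γ : List Bool) (d : ULift.{u} (ℕ × ℕ))
    (h : ∀ k, γ[k]? = some true → (⟨(d.down.1, d.down.2 + k)⟩ : ULift.{u} (ℕ × ℕ)) ∈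
      (P.model r s β f).conc 0) : d ∈ (wordConcept s γ).ext (P.model r s β f) := by
  induction γ generalizing d with
  | nil => exact Set.mem_univ _
  | cons b γ ih =>
    refine ⟨?_, ⟨(d.down.1, d.down.2 + 1)⟩, ih _ fun k hk => ?_, (mem_role_s hrs).2 rfl⟩
    · cases b with
      | false => exact Set.mem_univ _
      | true => exact h 0 rfl
    · have := h (k + 1) hk
      rwa [add_comm k, ← add_assoc] at this

theorem not_entails_of_tiling (hrs : r ≠ s) (hS : 0 < P.shift)
    (h : P.Tiling (fun _ _ => True) β) :
    ¬ TBox.Entails.{u} r s (P.tbox r s β) (query r P.shift) := by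
  obtain ⟨f, hheads, hadj, hinit, hcmp⟩ := h
  intro hent
  have hmodel : (P.model r s β f).IsModel (P.tbox r s β) := by
    rw [Interpretation.IsModel, tbox, List.forall_mem_cons]
    refine ⟨?_, P.isModel_rules.2 ⟨?_, ?_, ?_⟩⟩
    · rintro d -
      refine ⟨⟨(0, 0)⟩, ?_, Or.inr (Or.inr ⟨rfl, rfl⟩)⟩
      refine Concept.mem_ext_exIter.2 ⟨⟨(β.length, 0)⟩, ⟨?_, ?_⟩, ?_⟩
      · refine mem_wordConcept_model hrs _ _ fun k hk => Or.inl ⟨rfl, ?_⟩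
        simpa using hk
      · refine Concept.mem_ext_exIter.2 ⟨⟨(β.length + P.shift, 0)⟩, ⟨rfl, 0, by simp⟩, ?_⟩
        exact (model_rolePath_r hrs).2 (Or.inr ⟨rfl, rfl⟩)
      · exact (model_rolePath_r hrs).2 (Or.inr ⟨rfl, by simp⟩)
    · rintro ⟨⟨m, k⟩⟩ ⟨hk, n, hn⟩
      obtain rfl : k = 0 := hk
      exact ⟨f n 0, hheads n, mem_ext_tile.2 ⟨n, hn, rfl⟩⟩
    · rintro ⟨⟨m, k⟩⟩ ⟨hk, n, hn⟩
      obtain rfl : k = 0 := hk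
      obtain rfl : m = _ := hn
      refine ⟨⟨(β.length + P.shift * (n + 1 + 1), 0)⟩, ⟨rfl, n + 1, rfl⟩,
        (model_rolePath_r hrs).2 (Or.inr ⟨rfl, ?_⟩)⟩
      rw [mul_add _ (n + 1), ← add_assoc, mul_one]
    · rintro t ⟨⟨m, k⟩⟩ hd
      obtain ⟨n, hn, rfl⟩ := mem_ext_tile.1 hd
      refine ⟨⟨⟨(m, k + 1)⟩, ⟨_, hadj n k, mem_ext_tile.2 ⟨n, hn, rfl⟩⟩, (mem_role_s hrs).2 rfl⟩,
        fun hown => Or.inr ⟨n, hn, hown⟩, fun hpred => ⟨n, hn, hpred⟩⟩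
  obtain ⟨⟨x, x'⟩, ⟨m₁, k₁⟩, ⟨m₂, k₂⟩, u, v, ⟨i, g, hg1, hg2⟩, ⟨j, g', hg'1, hg'2⟩, ⟨l, hl⟩,
    ⟨l', hl'⟩, huv, h0, h1⟩ := satisfies_query.1 (hent _ hmodel)
  rw [model_rolePath_s hrs] at hl hl' hg2 hg'2
  rw [model_rolePath_r hrs] at huv hg1 hg'1
  obtain ⟨⟨u, u'⟩⟩ := u
  obtain ⟨⟨v, v'⟩⟩ := v
  simp only [hS.ne', false_and, false_or, Prod.mk.injEq] at huv hl hl'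
  obtain ⟨rfl, rfl, rfl⟩ := huv
  obtain ⟨rfl, rfl⟩ := hl
  obtain ⟨rfl, rfl⟩ := hl'
  -- If `x` is not a chain node, then `i = j = 0` and both elements lie in the column of `x`,
  -- although their columns are `P.shift > 0` apart. Otherwise the depths are `i` and `j`, which
  -- differ as the columns do.
  have hk : 0 + l' = 0 + l + P.shift := by
    obtain ⟨⟨a, b⟩⟩ := g
    obtain ⟨⟨a', b'⟩⟩ := g'
    simp only [Prod.mk.injEq, ULift.up.injEq] at hg1 hg'1 hg2 hg'2
    omega
  obtain ⟨n', hn', hpred⟩ := h1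
  dsimp only at hn' hpred
  rw [hk] at hpred
  rcases h0 with ⟨hm, hβ⟩ | ⟨n, hn, hown⟩
  · dsimp only at hm hβ
    rw [hm] at hn'
    have : n' + 1 = 1 := Nat.eq_of_mul_eq_mul_left hS (by omega)
    obtain rfl : n' = 0 := by omega
    exact hpred (hinit _ hβ)
  · dsimp only at hn hown
    rw [hn] at hn'
    have : n' + 1 = n + 1 + 1 := Nat.eq_of_mul_eq_mul_left hS (by rw [mul_add _ (n + 1)]; omega)
    obtain rfl : n' = n + 1 := by omega
    exact hpred (hcmp _ _ trivial hown)

end Model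

end TileSystem
end DL

namespace DL

/-! ### Cellular automata with growing rows

The letters of a row are written in one-hot blocks along a column. -/

namespace TileSystem

variable {σ : Type} (F : σ → σ → σ → Option σ) (b : σ)

/-- A sequence of rows `O n`, computed by the partial local rule `F` from their predecessors
`P n`; the word `w` is the row before the first one, and `R` says where `P (n + 1)` is known to
be a shift of `O n`. -/
def Rows (R : ℕ → ℕ → Prop) (w : List σ) : Prop :=
  ∃ P O : ℕ → ℕ → σ, (∀ n, P n 0 = b ∧ P n 1 = b) ∧
    (∀ n j, F (P n j) (P n (j + 1)) (P n (j + 2)) = some (O n j)) ∧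
    (∀ j o, w[j]? = some o → P 0 (j + 2) = o) ∧
    ∀ n j, R n j → P (n + 1) (j + 2) = O n j

variable [Fintype σ]

/-- Tiles: a position in a block together with a window of three letters. -/
abbrev Window (σ : Type) [Fintype σ] : Type := Fin (Fintype.card σ) × σ × σ × σ

/-- The letter computed in a window. -/
def Window.out (t : Window σ) : Option σ := F t.2.1 t.2.2.1 t.2.2.2

/-- All tiles of a block carry the same window, and windows of consecutive blocks overlap in two
letters. `own` holds the bits of the computed letter, `pred` those of the first letter of the
window. Requiring an output everywhere rules out columns for halted rows. -/
noncomputable def windows : TileSystem (Window σ) where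
  heads := {t | (t.out F).isSome ∧ (t.1 : ℕ) = 0 ∧ t.2.1 = b ∧ t.2.2.1 = b}
  adj t := {t' | (t'.out F).isSome ∧ (((t'.1 : ℕ) = t.1 + 1 ∧ t'.2 = t.2) ∨
    ((t.1 : ℕ) + 1 = Fintype.card σ ∧ (t'.1 : ℕ) = 0 ∧ t'.2.1 = t.2.2.1 ∧ t'.2.2.1 = t.2.2.2))}
  own := {t | ∃ o, t.out F = some o ∧ Fintype.equivFin σ o = t.1}
  pred := {t | Fintype.equivFin σ t.2.1 = t.1}
  shift := Fintype.card σ * 2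

noncomputable def oneHot (a : σ) : List Bool :=
  List.ofFn fun i : Fin (Fintype.card σ) => decide (Fintype.equivFin σ a = i)

theorem length_flatMap_oneHot (w : List σ) :
    (w.flatMap oneHot).length = Fintype.card σ * w.length := by
  induction w with
  | nil => rfl
  | cons a w ih =>
    rw [List.flatMap_cons, List.length_append, ih, oneHot, List.length_ofFn, List.length_cons]
    ring

theorem getElem?_flatMap_oneHot (w : List σ) (j : ℕ) (i : Fin (Fintype.card σ)) :
    (w.flatMap oneHot)[Fintype.card σ * j + i]? = some true ↔
      w[j]? = some ((Fintype.equivFin σ).symm i) := by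
  have hlen : ∀ a : σ, (oneHot a).length = Fintype.card σ := fun a => List.length_ofFn
  induction w generalizing j with
  | nil => simp
  | cons a w ih =>
    cases j with
    | zero =>
      rw [List.flatMap_cons, List.getElem?_append_left (by rw [hlen]; omega)]
      simp [oneHot, Equiv.eq_symm_apply]
    | succ j =>
      rw [List.flatMap_cons, List.getElem?_append_right (by rw [hlen, mul_add]; omega), hlen,
        List.getElem?_cons_succ]
      refine Eq.to_iff (congrArg (· = _) (congrArg _ ?_)) |>.trans (ih j)
      rw [mul_add]
      omega

/-! ### Tilings by windows and sequences of rows. -/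

variable {F b}

theorem windows_column {g : ℕ → Window σ} (h0 : g 0 ∈ (windows F b).heads)
    (hg : ∀ k, g (k + 1) ∈ (windows F b).adj (g k)) (j t : ℕ) (ht : t < Fintype.card σ) :
    ((g (Fintype.card σ * j + t)).1 : ℕ) = t ∧
      (g (Fintype.card σ * j + t)).2 = (g (Fintype.card σ * j)).2 ∧
      (g (Fintype.card σ * (j + 1))).2.1 = (g (Fintype.card σ * j)).2.2.1 ∧
      (g (Fintype.card σ * (j + 1))).2.2.1 = (g (Fintype.card σ * j)).2.2.2 := by
  have block : ∀ j, ((g (Fintype.card σ * j)).1 : ℕ) = 0 → ∀ t, t < Fintype.card σ →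
      ((g (Fintype.card σ * j + t)).1 : ℕ) = t ∧
        (g (Fintype.card σ * j + t)).2 = (g (Fintype.card σ * j)).2 := by
    intro j hj t
    induction t with
    | zero => exact fun _ => ⟨hj, rfl⟩
    | succ t ih =>
      intro ht
      obtain ⟨h1, h2⟩ := ih (by omega)
      rcases (hg (Fintype.card σ * j + t)).2 with ⟨h3, h4⟩ | ⟨h3, -⟩
      · exact ⟨by rw [← add_assoc, h3, h1], by rw [← add_assoc, h4, h2]⟩
      · omega
  have next : ∀ j, ((g (Fintype.card σ * j)).1 : ℕ) = 0 →
      ((g (Fintype.card σ * (j + 1))).1 : ℕ) = 0 ∧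
      (g (Fintype.card σ * (j + 1))).2.1 = (g (Fintype.card σ * j)).2.2.1 ∧
      (g (Fintype.card σ * (j + 1))).2.2.1 = (g (Fintype.card σ * j)).2.2.2 := by
    intro j hj
    obtain ⟨h1, h2⟩ := block j hj (Fintype.card σ - 1) (by omega)
    have hk : Fintype.card σ * (j + 1) = Fintype.card σ * j + (Fintype.card σ - 1) + 1 := by
      rw [mul_add]; omega
    -- The position in a block is bounded by its type, so a block that has reached its last tile
    -- must give way to the next.
    rcases (hg (Fintype.card σ * j + (Fintype.card σ - 1))).2 with ⟨h3, -⟩ | ⟨-, h4, h5, h6⟩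
    · have := (g (Fintype.card σ * j + (Fintype.card σ - 1) + 1)).1.2
      omega
    · rw [hk, ← h2]
      exact ⟨h4, h5, h6⟩
  have phase : ∀ j, ((g (Fintype.card σ * j)).1 : ℕ) = 0 := by
    intro j
    induction j with
    | zero => exact h0.2.1
    | succ j ih => exact (next j ih).1
  exact ⟨(block j (phase j) t ht).1, (block j (phase j) t ht).2, (next j (phase j)).2⟩

/-- Only the one bit that is on in the code of a letter is transferred; by one-hotness it identifies
the letter. The bound on bits is the bound on letters times the block length. -/
theorem rows_of_tiling {w : List σ}
    (h : (windows F b).Tiling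
      (fun n k => k < (w.flatMap oneHot).length + (windows F b).shift * (n + 1))
      (w.flatMap oneHot)) :
    Rows F b (fun n j => j < w.length + 2 * (n + 1)) w := by
  obtain ⟨f, hheads, hadj, hinit, hcmp⟩ := h
  have hN : 0 < Fintype.card σ := Fintype.card_pos_iff.2 ⟨b⟩
  have col := fun n => windows_column (hheads n) (hadj n)
  have hsome : ∀ n k, ((f n k).out F).isSome := by
    intro n k
    cases k with
    | zero => exact (hheads n).1
    | succ k => exact (hadj n k).1
  have hwin : ∀ n j t, t < Fintype.card σ → (f n (Fintype.card σ * j + t)).out F =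
      F (f n (Fintype.card σ * j)).2.1 (f n (Fintype.card σ * (j + 1))).2.1
        (f n (Fintype.card σ * (j + 2))).2.1 := by
    intro n j t ht
    rw [Window.out, (col n j t ht).2.1, (col n (j + 1) t ht).2.2.1, (col n j t ht).2.2.1,
      (col n j t ht).2.2.2]
  choose O hO using fun n j => Option.isSome_iff_exists.1 (hsome n (Fintype.card σ * j))
  have hpred : ∀ n j (i : Fin (Fintype.card σ)),
      f n (Fintype.card σ * j + i + (windows F b).shift) ∈ (windows F b).pred →
      (f n (Fintype.card σ * (j + 2))).2.1 = (Fintype.equivFin σ).symm i := by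
    intro n j i h
    have hk : Fintype.card σ * j + i + (windows F b).shift = Fintype.card σ * (j + 2) + i := by
      simp only [windows]; ring
    rw [hk] at h
    have h' : Fintype.equivFin σ (f n (Fintype.card σ * (j + 2) + i)).2.1 =
      (f n (Fintype.card σ * (j + 2) + i)).1 := h
    rw [(col n (j + 2) i i.2).2.1] at h'
    rw [Equiv.eq_symm_apply, h']
    exact Fin.ext (col n (j + 2) i i.2).1
  refine ⟨fun n j => (f n (Fintype.card σ * j)).2.1, O, fun n => ⟨(hheads n).2.2.1, ?_⟩,
    fun n j => ?_, fun j o hj => ?_, fun n j hj => ?_⟩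
  · exact (col n 0 0 hN).2.2.1.trans (hheads n).2.2.2
  · exact (hwin n j 0 hN).symm.trans (hO n j)
  · have := hpred 0 j (Fintype.equivFin σ o)
      (hinit _ ((getElem?_flatMap_oneHot _ _ _).2 (by rw [Equiv.symm_apply_apply, hj])))
    rwa [Equiv.symm_apply_apply] at this
  · have hi := (Fintype.equivFin σ (O n j)).2
    have := hpred (n + 1) j (Fintype.equivFin σ (O n j)) (hcmp n _ ?_ ⟨O n j, ?_, ?_⟩)
    · rwa [Equiv.symm_apply_apply] at this
    · rw [length_flatMap_oneHot]
      have hmul : Fintype.card σ * (j + 1) ≤ Fintype.card σ * (w.length + 2 * (n + 1)) :=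
        Nat.mul_le_mul_left _ hj
      have : Fintype.card σ * w.length + (windows F b).shift * (n + 1) =
        Fintype.card σ * (w.length + 2 * (n + 1)) := by simp only [windows]; ring
      rw [mul_add, mul_one] at hmul
      beta_reduce
      omega
    · rw [hwin n j _ hi, ← hwin n j 0 hN]
      exact hO n j
    · exact Fin.ext (col n j _ hi).1.symm

theorem tiling_of_rows {w : List σ} (h : Rows F b (fun _ _ => True) w) :
    (windows F b).Tiling (fun _ _ => True) (w.flatMap oneHot) := by
  obtain ⟨P, O, hb, hF, hw, hPO⟩ := h
  have hN : 0 < Fintype.card σ := Fintype.card_pos_iff.2 ⟨b⟩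
  let f : ℕ → ℕ → Window σ := fun n k =>
    (⟨k % Fintype.card σ, Nat.mod_lt _ hN⟩, P n (k / Fintype.card σ), P n (k / Fintype.card σ + 1),
      P n (k / Fintype.card σ + 2))
  have hout : ∀ n k, (f n k).out F = some (O n (k / Fintype.card σ)) := fun n k => hF _ _
  have hpred : ∀ n k, P n (k / Fintype.card σ + 2) =
      (Fintype.equivFin σ).symm ⟨k % Fintype.card σ, Nat.mod_lt _ hN⟩ →
      f n (k + (windows F b).shift) ∈ (windows F b).pred := by
    intro n k h
    have h1 : (k + Fintype.card σ * 2) / Fintype.card σ = k / Fintype.card σ + 2 :=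
      Nat.add_mul_div_left _ _ hN
    have h2 : (k + Fintype.card σ * 2) % Fintype.card σ = k % Fintype.card σ :=
      Nat.add_mul_mod_self_left _ _ _
    change Fintype.equivFin σ (P n ((k + Fintype.card σ * 2) / Fintype.card σ)) = _
    rw [h1, h, Equiv.apply_symm_apply]
    exact Fin.ext h2.symm
  refine ⟨f, fun n => ⟨?_, ?_, ?_, ?_⟩, fun n k => ⟨?_, ?_⟩, fun k hk => ?_, fun n k _ hown => ?_⟩
  · rw [hout]; rfl
  · exact Nat.zero_mod _
  · simpa [f] using (hb n).1
  · simpa [f] using (hb n).2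
  · rw [hout]; rfl
  · by_cases hk : k % Fintype.card σ + 1 = Fintype.card σ
    · have hk' : k + 1 = Fintype.card σ * (k / Fintype.card σ + 1) := by
        have := Nat.div_add_mod k (Fintype.card σ)
        rw [mul_add]; omega
      have hd : (k + 1) / Fintype.card σ = k / Fintype.card σ + 1 := by
        rw [hk', Nat.mul_div_cancel_left _ hN]
      refine Or.inr ⟨hk, ?_, ?_, ?_⟩
      · change (k + 1) % Fintype.card σ = 0
        rw [hk', Nat.mul_mod_right]
      · change P n ((k + 1) / Fintype.card σ) = _
        rw [hd]
      · change P n ((k + 1) / Fintype.card σ + 1) = _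
        rw [hd]
    · have hlt : k % Fintype.card σ + 1 < Fintype.card σ := by
        have := Nat.mod_lt k hN
        omega
      have hk' : k + 1 = k % Fintype.card σ + 1 + Fintype.card σ * (k / Fintype.card σ) := by
        have := Nat.div_add_mod k (Fintype.card σ)
        omega
      refine Or.inl ⟨?_, ?_⟩
      · change (k + 1) % Fintype.card σ = k % Fintype.card σ + 1
        conv_lhs => rw [hk']
        rw [Nat.add_mul_mod_self_left, Nat.mod_eq_of_lt hlt]
      · have hd : (k + 1) / Fintype.card σ = k / Fintype.card σ := by
          conv_lhs => rw [hk']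
          rw [Nat.add_mul_div_left _ _ hN, Nat.div_eq_of_lt hlt, zero_add]
        simp only [f, hd]
  · refine hpred 0 k (hw _ _ ?_)
    rw [← getElem?_flatMap_oneHot]
    rwa [Nat.div_add_mod]
  · obtain ⟨o, ho, hok⟩ := hown
    rw [hout, Option.some.injEq] at ho
    refine hpred (n + 1) k ?_
    rw [hPO n _ trivial, ho, Equiv.eq_symm_apply, hok]

end TileSystem
end DL

namespace DL

open Turing

/-! ### Turing machine runs as rows -/

/-- Turns divergence into an infinite sequence of configurations indexed by time. -/
theorem eval_dom_iff {α : Type*} (f : α → Option α) (a : α) :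
    (StateTransition.eval f a).Dom ↔
      ∃ n, (fun o : Option α => o.bind f)^[n] (some a) = none := by
  constructor
  · intro h
    obtain ⟨hreach, hb⟩ := StateTransition.mem_eval.1 (Part.get_mem h)
    revert hb
    generalize (StateTransition.eval f a).get h = b at hreach
    intro hb
    clear h
    induction hreach using Relation.ReflTransGen.head_induction_on with
    | refl => exact ⟨1, hb⟩
    | head hac _ ih =>
      obtain ⟨n, hn⟩ := ih
      refine ⟨n + 1, ?_⟩
      rw [Function.iterate_succ_apply, Option.bind_some, Option.mem_def.1 hac, hn]
  · rintro ⟨n, hn⟩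
    induction n generalizing a with
    | zero => cases hn
    | succ n ih =>
      rw [Function.iterate_succ_apply, Option.bind_some] at hn
      cases h : f a with
      | none => exact Part.dom_iff_mem.2 ⟨a, StateTransition.mem_eval.2 ⟨.refl, h⟩⟩
      | some a' =>
        rw [h] at hn
        rw [StateTransition.reaches_eval (Relation.ReflTransGen.single (Option.mem_def.2 h))]
        exact ih a' hn

namespace TapeRow

variable {Γ Q : Type} [Inhabited Γ] [Inhabited Q] (M : TM0.Machine Γ Q)

/-- The row of tape cells of a configuration with head position `p`, where the cell under the
head carries the state. -/
def row (c : TM0.Cfg Γ Q) (p z : ℤ) : Γ × Option Q :=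
  (c.Tape.nth (z - p), if z = p then some c.q else none)

def blank : Γ × Option Q := (default, none)

/-- The state with which the machine leaves a cell in direction `d`, if it does. -/
def leaving (d : Dir) (x : Γ × Option Q) : Option Q :=
  match x with
  | (_, none) => none
  | (a, some q) => match M q a with
    | some (q', .move d') => if d' = d then some q' else none
    | _ => none

/-- The next content of a cell, from its own content and that of its neighbours. -/
def cellRule (x y z : Γ × Option Q) : Option (Γ × Option Q) :=
  match y with
  | (a, some q) => (M q a).map fun t => match t with
    | (q', .write b) => (b, some q')
    | (_, .move _) => (a, none)
  | (a, none) => some (a, (leaving M .right x).or (leaving M .left z))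

/-- The rule for cells with a flag that marks the last cell of a row; the flag moves along. -/
def rule (x y z : (Γ × Option Q) × Bool) : Option ((Γ × Option Q) × Bool) :=
  (cellRule M x.1 (if x.2 then blank else y.1) (if x.2 || y.2 then blank else z.1)).map
    fun o => (o, x.2)

/-- The first row for a non-empty input. -/
def word (a : Γ) (l : List Γ) : List ((Γ × Option Q) × Bool) :=
  ((a, some default), false) :: l.map (fun x => ((x, none), false)) ++ [(blank, true)]

/-! ### Simulation of machine steps by the local rule. -/

variable {M}

/-- Tapes are indexed relative to the head and rows absolutely, so `p'` is the head position after
the step. Only the head cell and its two neighbours can change. -/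
theorem exists_cellRule_row {c c' : TM0.Cfg Γ Q} (h : TM0.step M c = some c') (p : ℤ) :
    ∃ p', ∀ z, cellRule M (row c p (z - 1)) (row c p z) (row c p (z + 1)) =
      some (row c' p' z) := by
  obtain ⟨q, T⟩ := c
  obtain ⟨⟨q', st⟩, hM, rfl⟩ := Option.map_eq_some_iff.1 h
  have hne : ∀ z, z ≠ p → row (⟨q, T⟩ : TM0.Cfg Γ Q) p z = (T.nth (z - p), none) := fun z hz => by
    rw [row, if_neg hz]
  have hp : row (⟨q, T⟩ : TM0.Cfg Γ Q) p p = (T.head, some q) := by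
    rw [row, if_pos rfl, sub_self]; rfl
  refine ⟨match st with | .move .left => p - 1 | .move .right => p + 1 | .write _ => p,
    fun z => ?_⟩
  have hcase : z = p ∨ z - 1 = p ∨ z + 1 = p ∨ (z ≠ p ∧ z - 1 ≠ p ∧ z + 1 ≠ p) := by omega
  rcases hcase with rfl | h1 | h1 | ⟨h1, h2, h3⟩
  · rw [hp, hne (z - 1) (by omega), hne (z + 1) (by omega)]
    rcases st with (_ | _) | b <;> simp [cellRule, hM, row] <;> first | rfl | omega
  · obtain rfl : z = p + 1 := by omega
    rw [add_sub_cancel_right, hp, hne (p + 1) (by omega), hne (p + 1 + 1) (by omega)]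
    rcases st with (_ | _) | b <;> simp [cellRule, leaving, hM, row] <;>
      first
      | omega
      | exact (Tape.move_right_nth T 0).symm
  · obtain rfl : z = p - 1 := by omega
    rw [sub_add_cancel, hp, hne (p - 1) (by omega), hne (p - 1 - 1) (by omega)]
    rcases st with (_ | _) | b <;> simp [cellRule, leaving, hM, row] <;>
      first
      | omega
      | exact (Tape.move_right_nth T 0).symm
      | exact (Tape.move_left_nth T 0).symm
      | exact ⟨congrArg _ (by omega), by omega⟩
  · rw [hne _ h1, hne _ h2, hne _ h3]
    rcases st with (_ | _) | b <;> simp [cellRule, leaving, row] <;>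
      first
      | exact ⟨congrArg _ (by omega), by omega⟩
      | exact ⟨fun _ => by omega, by omega⟩

theorem isSome_step_of_cellRule {c : TM0.Cfg Γ Q} {p : ℤ} {x z : Γ × Option Q}
    (h : (cellRule M x (row c p p) z).isSome) : (TM0.step M c).isSome := by
  obtain ⟨q, T⟩ := c
  rw [row, if_pos rfl, sub_self, cellRule, Option.isSome_map] at h
  rw [TM0.step, Option.isSome_map]
  exact h

/-- Only the cells from `-n` to `m + n - 1` of a row are used. -/
def Within (m n : ℕ) (ρ : ℤ → Γ × Option Q) : Prop :=
  ∀ z : ℤ, z < -n ∨ m + n ≤ z → ρ z = blank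

theorem Within.succ {m n : ℕ} {ρ ρ' : ℤ → Γ × Option Q} (h : Within m n ρ)
    (hρ : ∀ z, cellRule M (ρ (z - 1)) (ρ z) (ρ (z + 1)) = some (ρ' z)) : Within m (n + 1) ρ' := by
  intro z hz
  push_cast at hz
  have := hρ z
  rw [h (z - 1) (by omega), h z (by omega), h (z + 1) (by omega)] at this
  exact (Option.some.inj this).symm

theorem row_init_of_nat (a : Γ) (l : List Γ) (j : ℕ) :
    row (TM0.init (a :: l) : TM0.Cfg Γ Q) 0 j =
      ((a :: l).getI j, if j = 0 then some default else none) := by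
  rw [row, sub_zero]
  refine Prod.ext ?_ ?_
  · exact (Tape.mk'_nth_nat _ _ _).trans (ListBlank.nth_mk _ _)
  · simp [TM0.init]

theorem within_row_init (a : Γ) (l : List Γ) :
    Within (l.length + 1) 0 (row (TM0.init (a :: l) : TM0.Cfg Γ Q) 0) := by
  intro z hz
  cases z with
  | ofNat j =>
    have hj : (a :: l).length ≤ j := by simp at hz ⊢; omega
    have hj0 : j ≠ 0 := by simp at hj; omega
    rw [Int.ofNat_eq_natCast, row_init_of_nat, List.getI_eq_default _ hj, if_neg hj0]
    rfl
  | negSucc j =>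
    rw [row, if_neg (by omega), sub_zero]
    refine Prod.ext ?_ rfl
    exact (ListBlank.nth_mk [] j).trans (List.getI_eq_default _ (Nat.zero_le _))

theorem getElem?_word (a : Γ) (l : List Γ) {j : ℕ} (hj : j < l.length + 2) :
    (word a l)[j]? =
      some (row (TM0.init (a :: l) : TM0.Cfg Γ Q) 0 j, decide (j = l.length + 1)) := by
  rw [row_init_of_nat]
  cases j with
  | zero => simp [word]
  | succ j =>
    by_cases hj' : j < l.length
    · have : j ≠ l.length := hj'.ne
      simp [word, List.getElem?_append, hj', List.getI_eq_getElem _ hj', this]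
    · obtain rfl : j = l.length := by omega
      simp [word, blank, List.getI_eq_default]

/-- Row `n` starts at cell `-n - 2`, two blanks before the used part, and its flag sits on cell `m +
n`, the first unused one on the right. Replacing everything after the flag by blanks is thus
correct, whatever `P` contains there. -/
theorem rule_of_cellRule {m n : ℕ} {ρ ρ' : ℤ → Γ × Option Q} (h : Within m n ρ)
    (hρ : ∀ z, cellRule M (ρ (z - 1)) (ρ z) (ρ (z + 1)) = some (ρ' z))
    {P : ℕ → (Γ × Option Q) × Bool}
    (hP : ∀ j, j < m + 2 * n + 3 → P j = (ρ (j - n - 2), decide (j = m + 2 * n + 2)))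
    (j : ℕ) (hj : j < m + 2 * n + 3) :
    rule M (P j) (P (j + 1)) (P (j + 2)) = some (ρ' (j - n - 1), decide (j = m + 2 * n + 2)) := by
  have hx : ρ (j - n - 2) = ρ (((j : ℤ) - n - 1) - 1) := congrArg ρ (by ring)
  have hy : (if (P j).2 then blank else (P (j + 1)).1) = ρ ((j : ℤ) - n - 1) := by
    rw [hP j hj]
    split_ifs with hl
    · simp only [decide_eq_true_eq] at hl
      exact (h _ (by omega)).symm
    · simp only [decide_eq_true_eq] at hl
      rw [hP (j + 1) (by omega)]
      exact congrArg ρ (by push_cast; ring)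
  have hz : (if (P j).2 || (P (j + 1)).2 then blank else (P (j + 2)).1) =
      ρ (((j : ℤ) - n - 1) + 1) := by
    rw [hP j hj]
    by_cases hl : j < m + 2 * n + 1
    · rw [hP (j + 1) (by omega), hP (j + 2) (by omega), if_neg]
      · exact congrArg ρ (by push_cast; ring)
      · simp; omega
    · rw [if_pos, h _ (by omega)]
      by_cases hl' : j = m + 2 * n + 2
      · simp [hl']
      · obtain rfl : j = m + 2 * n + 1 := by omega
        rw [hP (m + 2 * n + 1 + 1) (by omega)]
        simp
  rw [rule, hy, hz, hP j hj, hx, hρ]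
  rfl

theorem rows_of_not_dom (a : Γ) (l : List Γ) (h : ¬ (TM0.eval M (a :: l)).Dom) :
    TileSystem.Rows (rule M) (blank, false) (fun _ _ => True) (word a l) := by
  have h' : ¬ (StateTransition.eval (TM0.step M) (TM0.init (a :: l))).Dom := h
  rw [eval_dom_iff] at h'
  push Not at h'
  choose c hc using fun n => Option.ne_none_iff_exists'.1 (h' n)
  have hc0 : c 0 = TM0.init (a :: l) := (Option.some.inj (hc 0)).symm
  have hstep : ∀ n, TM0.step M (c n) = some (c (n + 1)) := by
    intro n
    have := hc (n + 1)
    rwa [Function.iterate_succ_apply', hc n] at this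
  choose nx hnx using fun n => exists_cellRule_row (hstep n)
  let p : ℕ → ℤ := fun n => Nat.rec 0 (fun n q => nx n q) n
  have hrow : ∀ n z, cellRule M (row (c n) (p n) (z - 1)) (row (c n) (p n) z)
      (row (c n) (p n) (z + 1)) = some (row (c (n + 1)) (p (n + 1)) z) := fun n => hnx n (p n)
  have hwithin : ∀ n, Within (l.length + 1) n (row (c n) (p n)) := by
    intro n
    induction n with
    | zero => rw [hc0]; exact within_row_init a l
    | succ n ih => exact ih.succ (hrow n)
  have hblank : ∀ n, ∀ j < 2, (row (c n) (p n) ((j : ℕ) - n - 2),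
      decide (j = l.length + 1 + 2 * n + 2)) = (blank, false) := by
    intro n j hj
    rw [hwithin n _ (by omega), decide_eq_false (by omega)]
  refine ⟨fun n j => (row (c n) (p n) (j - n - 2), decide (j = l.length + 1 + 2 * n + 2)),
    fun n j => (row (c (n + 1)) (p (n + 1)) (j - n - 1), decide (j = l.length + 1 + 2 * n + 2)),
    fun n => ⟨hblank n 0 (by omega), hblank n 1 (by omega)⟩, fun n j => ?_, fun j o hj => ?_,
    fun n j _ => ?_⟩
  · by_cases hj : j < l.length + 1 + 2 * n + 3
    · exact rule_of_cellRule (hwithin n) (hrow n) (fun _ _ => rfl) j hj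
    -- Past the flag the window is blank and unflagged, and so is its output.
    · have h1 : ∀ i, j ≤ i → (row (c n) (p n) ((i : ℕ) - n - 2),
          decide (i = l.length + 1 + 2 * n + 2)) = (blank, false) := by
        intro i hi
        rw [hwithin n _ (by omega), decide_eq_false (by omega)]
      beta_reduce
      rw [h1 j le_rfl, h1 (j + 1) (by omega), h1 (j + 2) (by omega),
        hwithin (n + 1) _ (by push_cast; omega), decide_eq_false (by omega)]
      rfl
  · have hlen : j < l.length + 2 := by
      by_contra hlen
      rw [List.getElem?_eq_none (by simp [word]; omega)] at hj
      cases hj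
    rw [getElem?_word a l hlen, Option.some.injEq] at hj
    rw [← hj]
    refine Prod.ext ?_ ?_
    · change row (c 0) 0 _ = _
      rw [hc0]
      exact congrArg (row _ _) (by push_cast; ring)
    · simp
  · refine Prod.ext (congrArg (row _ _) (by push_cast; ring)) ?_
    simp only [decide_eq_decide]
    omega

/-- The bound in the hypothesis is exactly the length `m + 2 * n + 3` of row `n`, where `m =
l.length + 1`. So rows are known up to and including their flag, which is all that the rule looks
at. -/
theorem not_dom_of_rows (a : Γ) (l : List Γ)
    (h : TileSystem.Rows (rule M) (blank, false)
      (fun n j => j < (word (Q := Q) a l).length + 2 * (n + 1)) (word a l)) :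
    ¬ (TM0.eval M (a :: l)).Dom := by
  change ¬ (StateTransition.eval (TM0.step M) (TM0.init (a :: l))).Dom
  rw [eval_dom_iff]
  push Not
  obtain ⟨P, O, hb, hO, hw, hPO⟩ := h
  have hlen : (word (Q := Q) a l).length = l.length + 2 := by simp [word]
  rw [hlen] at hPO
  suffices H : ∀ n, ∃ c p, (fun o : Option (TM0.Cfg Γ Q) => o.bind (TM0.step M))^[n]
      (some (TM0.init (a :: l))) = some c ∧ Within (l.length + 1) n (row c p) ∧
      ∀ j, j < l.length + 1 + 2 * n + 3 →
        P n j = (row c p (j - n - 2), decide (j = l.length + 1 + 2 * n + 2)) by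
    intro n
    obtain ⟨c, p, hc, -⟩ := H n
    rw [hc]
    exact Option.some_ne_none _
  intro n
  induction n with
  | zero =>
    have hin := within_row_init (Q := Q) a l
    refine ⟨_, 0, rfl, hin, fun j hj => ?_⟩
    match j, hj with
    | 0, _ => rw [(hb 0).1, hin _ (by omega), decide_eq_false (by omega)]
    | 1, _ => rw [(hb 0).2, hin _ (by omega), decide_eq_false (by omega)]
    | j + 2, hj =>
      rw [hw j _ (getElem?_word a l (by omega))]
      refine Prod.ext (congrArg (row _ _) (by push_cast; ring)) ?_
      simp
  | succ n ih =>
    obtain ⟨c, p, hc, hin, hP⟩ := ih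
    -- The head cell carries a state, so it is not blank and lies in the used part.
    have hp : ¬ (p < -n ∨ (l.length + 1 : ℕ) + n ≤ p) := by
      intro hp
      have := congrArg Prod.snd (hin p hp)
      simp [row, blank] at this
    have hsome : (TM0.step M c).isSome := by
      -- The window starting at this `j` is centred at the head; its having an output means that the
      -- machine can move.
      obtain ⟨j, hj⟩ : ∃ j : ℕ, (j : ℤ) = p + n + 1 := ⟨(p + n + 1).toNat, by omega⟩
      have h1 := hO n j
      rw [hP j (by omega), hP (j + 1) (by omega), hP (j + 2) (by omega), rule,
        decide_eq_false (by omega), decide_eq_false (by omega)] at h1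
      have hjp : ((j + 1 : ℕ) : ℤ) - n - 2 = p := by push_cast; omega
      rw [hjp] at h1
      have h2 := congrArg Option.isSome h1
      rw [Option.isSome_map] at h2
      exact isSome_step_of_cellRule h2
    obtain ⟨c', hc'⟩ := Option.isSome_iff_exists.1 hsome
    obtain ⟨p', hp'⟩ := exists_cellRule_row hc' p
    have hin' := hin.succ hp'
    refine ⟨c', p', ?_, hin', fun j hj => ?_⟩
    · rw [Function.iterate_succ_apply', hc]
      exact hc'
    · match j, hj with
      | 0, _ => rw [(hb _).1, hin' _ (by push_cast; omega), decide_eq_false (by omega)]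
      | 1, _ => rw [(hb _).2, hin' _ (by push_cast; omega), decide_eq_false (by omega)]
      | j + 2, hj =>
        rw [hPO n j (by omega)]
        have h1 := hO n j
        rw [rule_of_cellRule hin hp' hP j (by omega), Option.some.injEq] at h1
        rw [← h1]
        refine Prod.ext (congrArg (row _ _) (by push_cast; ring)) ?_
        simp only [decide_eq_decide]
        omega

end TapeRow
end DL

namespace DL

/-! ### Computability of the reduction -/

theorem Concept.primrec_inter : Primrec₂ Concept.inter :=
  Primrec.encode_iff.1 <| show Primrec fun p : Concept × Concept =>
      4 * Nat.pair (Encodable.encode p.1) (Encodable.encode p.2) + 3 from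
    Primrec.nat_add.comp (Primrec.nat_mul.comp (Primrec.const 4)
      (Primrec₂.natPair.comp (Primrec.encode.comp Primrec.fst) (Primrec.encode.comp Primrec.snd)))
      (Primrec.const 3)

theorem Concept.primrec_ex (ρ : RoleName) : Primrec (Concept.ex ρ) :=
  Primrec.encode_iff.1 <| show Primrec fun C : Concept =>
      4 * Nat.pair ρ (Encodable.encode C) + 4 from
    Primrec.nat_add.comp (Primrec.nat_mul.comp (Primrec.const 4)
      (Primrec₂.natPair.comp (Primrec.const ρ) Primrec.encode)) (Primrec.const 4)

theorem TileSystem.primrec_wordConcept (s : RoleName) : Primrec (wordConcept s) := by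
  have hbit : Primrec fun b : Bool => if b then Concept.atom 0 else Concept.top :=
    Primrec.dom_finite _
  exact Primrec.list_foldr Primrec.id (Primrec.const Concept.top)
    (Concept.primrec_inter.comp (hbit.comp (Primrec.fst.comp Primrec.snd))
      ((Concept.primrec_ex s).comp (Primrec.snd.comp Primrec.snd))).to₂

theorem TileSystem.primrec_startConcept (r s : RoleName) (S : ℕ) :
    Primrec (startConcept r s S) :=
  Primrec.nat_iterate Primrec.list_length
    (Concept.primrec_inter.comp (primrec_wordConcept s) (Primrec.const _))
    ((Concept.primrec_ex r).comp Primrec.snd).to₂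

theorem TileSystem.primrec_tbox {τ : Type} [Fintype τ] (P : TileSystem τ) (r s : RoleName) :
    Primrec (P.tbox r s) :=
  Primrec.list_cons.comp (Primrec.pair (Primrec.const _)
    ((Concept.primrec_ex _).comp (primrec_startConcept r s P.shift))) (Primrec.const _)

theorem primrec_nat_bits : Primrec Nat.bits := by
  -- The list `l` tabulates the bits of all smaller numbers, and its length is the current number.
  have hg : Primrec₂ fun (_ : Unit) (l : List (List Bool)) =>
      (some (if l.length = 0 then [] else l.length.bodd :: l.getD l.length.div2 []) :
        Option (List Bool)) := by
    have hlen : Primrec fun p : Unit × List (List Bool) => p.2.length :=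
      Primrec.list_length.comp Primrec.snd
    exact (Primrec.option_some.comp (Primrec.ite (PrimrecRel.comp Primrec.eq hlen (Primrec.const 0))
      (Primrec.const []) (Primrec.list_cons.comp (Primrec.nat_bodd.comp hlen)
        ((Primrec.list_getD []).comp Primrec.snd (Primrec.nat_div2.comp hlen))))).to₂
  refine (Primrec.nat_strong_rec (fun (_ : Unit) n => n.bits) hg fun _ n => ?_).comp
    (Primrec.const ()) Primrec.id
  rw [List.length_map, List.length_range, Option.some.injEq]
  split_ifs with hn
  · rw [hn, Nat.zero_bits]
  · have hlt : n.div2 < n := by rw [Nat.div2_val]; omega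
    rw [List.getD_eq_getElem _ _ (by simpa using hlt)]
    simp only [List.getElem_map, List.getElem_range]
    conv_rhs => rw [← Nat.bit_bodd_div2 n]
    refine (Nat.bits_append_bit _ _ fun h0 => ?_).symm
    by_contra hb
    rw [Bool.not_eq_true] at hb
    apply hn
    rw [← Nat.bit_bodd_div2 n, h0, hb]
    rfl

end DL

namespace DL

open Turing

/-! ### A universal machine and the reduction -/

theorem trNat_eq_map_bits (n : ℕ) : PartrecToTM2.trNat n =
    n.bits.map (fun b => bif b then PartrecToTM2.Γ'.bit1 else PartrecToTM2.Γ'.bit0) := by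
  have key : ∀ m : Num, PartrecToTM2.trNum m = (m : ℕ).bits.map
      (fun b => bif b then PartrecToTM2.Γ'.bit1 else PartrecToTM2.Γ'.bit0) := by
    rintro (_ | p)
    · rfl
    · change PartrecToTM2.trPosNum p = (p : ℕ).bits.map _
      induction p with
      | one => simp [PartrecToTM2.trPosNum]
      | bit1 p ih =>
        rw [PosNum.cast_bit1, ← two_mul, Nat.bit1_bits, List.map_cons, ← ih]
        rfl
      | bit0 p ih =>
        rw [PosNum.cast_bit0, ← two_mul, Nat.bit0_bits _ (PosNum.to_nat_pos p).ne', List.map_cons,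
          ← ih]
        rfl
  rw [PartrecToTM2.trNat, key, Num.to_of_nat]

/-- A code for `f` is compiled to a stack machine, then to a `TM1` and a `TM0` machine. The latter
is restricted to a finite set `S0` of states supporting its run, since rows need a finite alphabet.
-/
theorem exists_universal_machine (f : ℕ →. ℕ) (hf : Partrec f) :
    ∃ (Γ Q : Type) (_ : Fintype Γ) (_ : Fintype Q) (_ : Inhabited Γ) (_ : Inhabited Q)
      (M : TM0.Machine Γ Q) (a : Γ) (g : Bool → Γ),
      ∀ n, (TM0.eval M (a :: n.bits.reverse.map g)).Dom ↔ (f n).Dom := by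
  classical
  obtain ⟨c, hc⟩ := ToPartrec.Code.exists_code (Nat.Partrec'.part_iff₁.2 hf)
  -- The default label is the initial state, so this instance makes the machine start with the code
  -- `c`.
  let _ : Inhabited PartrecToTM2.Λ' := ⟨PartrecToTM2.trNormal c .halt⟩
  let M1 := TM2to1.tr PartrecToTM2.tr
  have ss1 := TM2to1.tr_supports PartrecToTM2.tr (PartrecToTM2.tr_supports c .halt)
  let M0 := TM1to0.tr M1
  have ss0 := TM1to0.tr_supports M1 ss1
  let S0 : Finset (TM1to0.Λ' M1) :=
    TM1to0.trStmts M1 (TM2to1.trSupp PartrecToTM2.tr (PartrecToTM2.codeSupp c .halt))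
  let _ : Inhabited S0 := ⟨⟨default, ss0.1⟩⟩
  let g₁ : PointedMap (TM1to0.Λ' M1) S0 :=
    ⟨fun q => if h : q ∈ S0 then ⟨q, h⟩ else default, dif_pos ss0.1⟩
  have hg₁ : ∀ q ∈ (S0 : Set (TM1to0.Λ' M1)), ((g₁ q : S0) : TM1to0.Λ' M1) = q := fun q hq =>
    congrArg Subtype.val (dif_pos hq)
  let id' : PointedMap (TM2to1.Γ' PartrecToTM2.K' fun _ => PartrecToTM2.Γ')
      (TM2to1.Γ' PartrecToTM2.K' fun _ => PartrecToTM2.Γ') := ⟨id, rfl⟩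
  let _ : Fintype PartrecToTM2.K' :=
    ⟨{.main, .rev, .aux, .stack}, by rintro (_ | _ | _ | _) <;> simp⟩
  refine ⟨_, S0, inferInstance, inferInstance, inferInstance, inferInstance,
    M0.map id' id' g₁ Subtype.val,
    (true, Function.update (fun _ => none) .main (some .cons)),
    fun b => (false, Function.update (fun _ => none) .main (some (bif b then .bit1 else .bit0))),
    fun n => ?_⟩
  have h1 := StateTransition.tr_eval_dom
    (M0.map_respects id' id' g₁ Subtype.val ss0 (fun _ => rfl) hg₁)
    (a₁ := TM0.init (TM2to1.trInit .main (PartrecToTM2.trList [n]))) ⟨ss0.1, rfl⟩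
  rw [TM0.map_init] at h1
  have h2 : (TM0.eval M0 (TM2to1.trInit .main (PartrecToTM2.trList [n]))).Dom ↔
    (TM2.eval PartrecToTM2.tr .main (PartrecToTM2.trList [n])).Dom := by
    rw [TM1to0.tr_eval]
    exact TM2to1.tr_eval_dom _ _ _
  have h3 : (TM2.init .main (PartrecToTM2.trList [n]) : PartrecToTM2.Cfg') =
      PartrecToTM2.init c [n] := by
    rw [TM2.init, PartrecToTM2.init]
    congr
    funext k
    cases k <;> rfl
  have h4 : (TM2.eval PartrecToTM2.tr .main (PartrecToTM2.trList [n])).Dom ↔ (f n).Dom := by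
    change (StateTransition.eval _
      (TM2.init .main (PartrecToTM2.trList [n]) : PartrecToTM2.Cfg')).Dom ↔ _
    rw [h3, PartrecToTM2.tr_eval]
    change (c.eval [n]).Dom ↔ _
    rw [show c.eval [n] = pure <$> f n from hc ⟨[n], rfl⟩]
    rfl
  -- The stack is stored bottom first: the terminator `cons` comes first with the bottom mark, then
  -- the bits from the most significant one.
  have h5 : (TM2to1.trInit .main (PartrecToTM2.trList [n])).map id' =
      (true, Function.update (fun _ => none) .main (some .cons)) ::
        n.bits.reverse.map (fun b =>
          (false, Function.update (fun _ => none) .main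
            (some (bif b then .bit1 else .bit0)))) := by
    change List.map id _ = _
    simp only [List.map_id_fun, id_eq, TM2to1.trInit, PartrecToTM2.trList, trNat_eq_map_bits,
      List.reverse_append, List.reverse_singleton, List.singleton_append, ← List.map_reverse]
    exact congrArg (List.cons _) List.map_map
  rw [h5] at h1
  rw [← h4, ← h2]
  exact h1

theorem primrec_word {Γ Q : Type} [Inhabited Γ] [Inhabited Q] [Fintype Γ] [Fintype Q] (a : Γ)
    (g : Bool → Γ) : Primrec fun n : ℕ =>
      (TapeRow.word (Q := Q) a (n.bits.reverse.map g)).flatMap TileSystem.oneHot := by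
  have hbit : Primrec fun b : Bool =>
      TileSystem.oneHot (((g b, none), false) : (Γ × Option Q) × Bool) := Primrec.dom_finite _
  have h : Primrec fun n : ℕ =>
      TileSystem.oneHot (((a, some default), false) : (Γ × Option Q) × Bool) ++
        (n.bits.reverse.flatMap fun b =>
          TileSystem.oneHot (((g b, none), false) : (Γ × Option Q) × Bool)) ++
        TileSystem.oneHot ((TapeRow.blank, true) : (Γ × Option Q) × Bool) :=
    Primrec.list_append.comp (Primrec.list_append.comp (Primrec.const _)
      (Primrec.list_flatMap (Primrec.list_reverse.comp primrec_nat_bits)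
        (hbit.comp Primrec.snd).to₂)) (Primrec.const _)
  refine h.of_eq fun n => ?_
  simp [TapeRow.word, List.flatMap_map, -List.map_reverse]

theorem exists_computable_reduction (r s : RoleName) (hrs : r ≠ s) (f : ℕ →. ℕ) (hf : Partrec f) :
    ∃ g : ℕ → TBox × CQ, Computable g ∧
      ∀ n, (f n).Dom ↔ TBox.Entails.{u} r s (g n).1 (g n).2 := by
  obtain ⟨Γ, Q, _, _, _, _, M, a, g, hM⟩ := exists_universal_machine f hf
  let P := TileSystem.windows (TapeRow.rule M) (TapeRow.blank, false)
  let w : ℕ → List ((Γ × Option Q) × Bool) := fun n => TapeRow.word a (n.bits.reverse.map g)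
  refine ⟨fun n => (P.tbox r s ((w n).flatMap TileSystem.oneHot), TileSystem.query r P.shift),
    (Primrec.pair ((P.primrec_tbox r s).comp (primrec_word a g)) (Primrec.const _)).to_comp,
    fun n => ?_⟩
  rw [← hM n, ← not_iff_not]
  constructor
  · intro h
    refine P.not_entails_of_tiling hrs (Nat.mul_pos Fintype.card_pos two_pos) ?_
    exact TileSystem.tiling_of_rows (TapeRow.rows_of_not_dom a _ h)
  · intro h
    exact TapeRow.not_dom_of_rows a _ (TileSystem.rows_of_tiling (P.tiling_of_not_entails h))

end DL

theorem mainTheorem3 (r s : DL.RoleName) (hrs : r ≠ s) :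
    ¬ ComputablePred (fun p : DL.TBox × DL.CQ => DL.TBox.Entails.{u} r s p.1 p.2) := by
  intro h
  have hf : Partrec fun n : ℕ => Nat.Partrec.Code.eval (Denumerable.ofNat _ n) 0 :=
    Nat.Partrec.Code.eval_part.comp (Computable.ofNat _) (Computable.const 0)
  obtain ⟨g, hg, hfg⟩ := DL.exists_computable_reduction.{u} r s hrs _ hf
  refine ComputablePred.halting_problem 0 (ComputablePred.computable_of_manyOneReducible
    ⟨fun c => g (Encodable.encode c), hg.comp Computable.encode, fun c => ?_⟩ h)
  rw [← hfg, Denumerable.ofNat_encode]
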